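/- Let $X$ be a Tychonoff space and let $C_p(X)$ be the space of continuous functions $X\to\mathbb R$ with the topology of pointwise convergence. Definitions. A subset $D$ of a space $Z$ is sequentially dense if every point of $Z$ is the limit of a sequence of elements of $D$; $Z$ is sequentially separable if it has a countable sequentially dense subset. A set $A\subseteq Z$ converges to $z\in Z$ if $A$ is infinite, $z\notin A$, and $A\setminus W$ is finite for every neighbourhood $W$ of $z$. Let $\mathcal S$ be the family of sequentially dense subsets of $C_p(X)$ and, for $f\in C_p(X)$, let $\Gamma_f$ be the family of subsets of $C_p(X)$ that converge to $f$. Call a sequence $(\mathcal F_n)_{n}$ of finite subsets of $C_p(X)$ *$U$-convergent* to $f\in C_p(X)$ if for every finite $K\subseteq X$ and every $\varepsilon>0$ there is $n'$ such that for all $n>n'$ and all $x\in K$ there is $g\in\mathcal F_n$ with $|g(x)-f(x)|<\varepsilon$. Then: - $C_p(X)\models U_{fin}(\mathcal S,\mathcal S)$ means: for all $S_1,S_2,\dots\in\mathcal S$ there are finite $\mathcal F_n\subseteq S_n$ such that $(\mathcal F_n)$ is $U$-convergent to every $f\in C_p(X)$; - $C_p(X)\models U_{fin}(\Gamma_x,\Gamma_x)$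 means: for every $f\in C_p(X)$ and all $S_1,S_2,\dots\in\Gamma_f$ there are finite $\mathcal F_n\subseteq S_n$ such that $(\mathcal F_n)$ is $U$-convergent to $f$; - $C_p(X)\models U_{fin}(\mathcal S,\Gamma_x)$ means: for every $f\in C_p(X)$ and all $S_1,S_2,\dots\in\mathcal S$ there are finite $\mathcal F_n\subseteq S_n$ such that $(\mathcal F_n)$ is $U$-convergent to $f$. A $\gamma$-cover of $X$ is an infinite family $\mathcal U$ of subsets of $X$ with $\bigcup\mathcal U=X$ and $X\notin\mathcal U$ such that every $x\in X$ belongs to all but finitely many members of $\mathcal U$. Let $\Gamma$ be the family of $\gamma$-covers of $X$ by open sets. Let $\Gamma_F$ be the family of $\gamma$-covers $\mathcal U$ of $X$ by cozero-sets for which there is a $\gamma$-cover $\{F(U):U\in\mathcal U\}$ of $X$ by zero-sets with $F(U)\subseteq U$ for every $U\in\mathcal U$. Here a zero-set of $X$ is the preimage of $0$ under a continuous real-valued function on $X$, and a cozero-set is the complement of a zero-set. $X\models U_{fin}(\Gamma_F,\Gamma)$ means: whenever $\mathcal U_1,\mathcal U_2,\dots\in\Gamma_F$ and no $\mathcal U_n$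 contains a finite subcover of $X$, there are finite $\mathcal F_n\subseteq\mathcal U_n$ such that $\{\bigcup\mathcal F_n:n\}\in\Gamma$. $X$ has property $V$ if there are a separable metric space $Y$ and a continuous bijection $f:X\to Y$ such that $f(U)$ is an $F_\sigma$-set of $Y$ for every cozero-set $U$ of $X$. **Theorem.** The following are equivalent: 1. $C_p(X)\models U_{fin}(\mathcal S,\mathcal S)$ and $C_p(X)$ is sequentially separable; 2. $X\models U_{fin}(\Gamma_F,\Gamma)$ and $X$ has property $V$; 3. $C_p(X)\models U_{fin}(\Gamma_x,\Gamma_x)$ and $C_p(X)$ is sequentially separable; 4. $C_p(X)\models U_{fin}(\mathcal S,\Gamma_x)$ and $C_p(X)$ is sequentially separable. -/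

import Mathlib

open Set Filter Topology

universe u

namespace CpSel

section Spaces

variable {X : Type u} [TopologicalSpace X]

/-- A zero-set: the preimage of zero under a continuous real-valued function. -/
def IsZeroSet (Z : Set X) : Prop :=
  ∃ f : X → ℝ, Continuous f ∧ Z = {x | f x = 0}

/-- A cozero-set (functionally open set): the complement of a zero-set. -/
def IsCozeroSet (U : Set X) : Prop :=
  IsZeroSet Uᶜ

/-- An `F_σ`-set: the union of a countable family of closed sets. -/
def IsFSigma (A : Set X) : Prop :=
  ∃ T : Set (Set X), T.Countable ∧ (∀ C ∈ T, IsClosed C) ∧ A = ⋃₀ T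

/-- A `γ`-cover: a nontrivial cover (the whole space is not a member) that is infinite and such
that each point belongs to all but finitely many of its members. -/
def IsGammaCover (𝒰 : Set (Set X)) : Prop :=
  ⋃₀ 𝒰 = univ ∧ univ ∉ 𝒰 ∧ 𝒰.Infinite ∧ ∀ x : X, {U ∈ 𝒰 | x ∉ U}.Finite

variable (X) in
/-- `Γ`: the family of open `γ`-covers. -/
def Gamma : Set (Set (Set X)) :=
  {𝒰 | IsGammaCover 𝒰 ∧ ∀ U ∈ 𝒰, IsOpen U}

variable (X) in
/-- `Γ_F`: the family of `γ_F`-shrinkable `γ`-covers, that is, of `γ`-covers by cozero-sets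
such that there is a `γ`-cover `{F U : U ∈ 𝒰}` by zero-sets with `F U ⊆ U` for all `U ∈ 𝒰`. -/
def GammaF : Set (Set (Set X)) :=
  {𝒰 | IsGammaCover 𝒰 ∧ (∀ U ∈ 𝒰, IsCozeroSet U) ∧
    ∃ F : Set X → Set X, IsGammaCover (F '' 𝒰) ∧ ∀ U ∈ 𝒰, IsZeroSet (F U) ∧ F U ⊆ U}

/-- The selection principle `U_fin(𝒜, ℬ)` for families of covers of `X`: for each sequence of
members of `𝒜`, none of which contains a finite subcover, there are finite subfamilies whose
unions form a member of `ℬ`. -/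
def UFin (𝒜 ℬ : Set (Set (Set X))) : Prop :=
  ∀ 𝒰 : ℕ → Set (Set X), (∀ n, 𝒰 n ∈ 𝒜) →
    (∀ n, ¬ ∃ ℱ : Set (Set X), ℱ ⊆ 𝒰 n ∧ ℱ.Finite ∧ ⋃₀ ℱ = univ) →
    ∃ ℱ : ℕ → Set (Set X), (∀ n, ℱ n ⊆ 𝒰 n ∧ (ℱ n).Finite) ∧
      range (fun n => ⋃₀ ℱ n) ∈ ℬ

variable (X) in
/-- Property `V`: there is a condensation (continuous bijection) of `X` onto a separable metric
space that maps each cozero-set of `X` to an `F_σ`-set. (A condensation is bijective, so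
restricting `Y` to the universe of `X` loses nothing.) -/
def PropertyV : Prop :=
  ∃ (Y : Type u) (_ : MetricSpace Y) (_ : TopologicalSpace.SeparableSpace Y) (f : X → Y),
    Continuous f ∧ Function.Bijective f ∧ ∀ U : Set X, IsCozeroSet U → IsFSigma (f '' U)

variable (X) in
/-- A sequentially dense set: each point of the space is the limit of a sequence from it. -/
def SeqDense : Set (Set X) :=
  {D | seqClosure D = univ}

variable (X) in
/-- A sequentially separable space: one with a countable sequentially dense subset. -/
def SequentiallySeparable : Prop :=
  ∃ D : Set X, D.Countable ∧ D ∈ SeqDense X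

/-- `Γ_x`: the family of sets converging to `x`, that is, of infinite sets `A` with `x ∉ A`
such that `A \ U` is finite for each neighbourhood `U` of `x`. -/
def GammaAt (x : X) : Set (Set X) :=
  {A | A.Infinite ∧ x ∉ A ∧ ∀ U ∈ 𝓝 x, (A \ U).Finite}

end Spaces

/-- `C_p(X)`: the continuous real-valued functions on `X` with the topology of pointwise
convergence (the subspace topology induced from the product `ℝ^X`). -/
abbrev Cp (X : Type u) [TopologicalSpace X] : Type u :=
  {f : X → ℝ // Continuous f}

section FunctionSpaces

variable {X : Type u} [TopologicalSpace X]

/-- The sets `ℱ n` of functions `U`-converge to `f`: for each basic neighbourhood `⟨f, K, ε⟩`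
of `f`, for all but finitely many `n` each point `x ∈ K` has some `g ∈ ℱ n` with
`|g x - f x| < ε` (the function `g` may depend on `x`). -/
def UConverges (ℱ : ℕ → Set (Cp X)) (f : Cp X) : Prop :=
  ∀ (K : Finset X) (ε : ℝ), 0 < ε →
    ∃ N : ℕ, ∀ n > N, ∀ x ∈ K, ∃ g ∈ ℱ n, |g.1 x - f.1 x| < ε

variable (X) in
/-- `C_p(X) ⊨ U_fin(𝒮, 𝒮)`: one selection works for all `f`. -/
def UFinSS : Prop :=
  ∀ S : ℕ → Set (Cp X), (∀ n, S n ∈ SeqDense (Cp X)) →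
    ∃ ℱ : ℕ → Set (Cp X), (∀ n, ℱ n ⊆ S n ∧ (ℱ n).Finite) ∧ ∀ f : Cp X, UConverges ℱ f

variable (X) in
/-- `C_p(X) ⊨ U_fin(Γ_x, Γ_x)`, at each point `x = f` of `C_p(X)`. -/
def UFinGammaGamma : Prop :=
  ∀ f : Cp X, ∀ S : ℕ → Set (Cp X), (∀ n, S n ∈ GammaAt f) →
    ∃ ℱ : ℕ → Set (Cp X), (∀ n, ℱ n ⊆ S n ∧ (ℱ n).Finite) ∧ UConverges ℱ f

variable (X) in
/-- `C_p(X) ⊨ U_fin(𝒮, Γ_x)`, at each point `x = f` of `C_p(X)`. -/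
def UFinSGamma : Prop :=
  ∀ f : Cp X, ∀ S : ℕ → Set (Cp X), (∀ n, S n ∈ SeqDense (Cp X)) →
    ∃ ℱ : ℕ → Set (Cp X), (∀ n, ℱ n ⊆ S n ∧ (ℱ n).Finite) ∧ UConverges ℱ f

end FunctionSpaces

end CpSel

/-!
If `g k → f` in `C_p(X)`, then the cozero-sets `|g k - f| < ε`, shrunk to the zero-sets
`|g k - f| ≤ ε / 2`, form a member of `Γ_F` up to repetitions, and letting `ε → 0` along a sequence
of covers turns the selections of `U_fin(Γ_F, Γ)` into selections `U`-convergent to `f`. Conversely,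
if the `U k` are cozero-sets that shrink to zero-sets `F k` as in `Γ_F`, then the functions equal to
`1` off some `U k` form a sequentially dense set, and where `|g| < 1` for such a `g`, we are inside
the corresponding `U k`; hence a finite selection `U`-convergent to `0` selects finitely many `U k`.
The `U`-limits of a selection form a closed set, so when `C_p(X)` is separable, merging the
selections for the points of a countable dense set gives one that is `U`-convergent to every `f`.

Property `V` amounts to sequential separability of `C_p(X)`. Evaluation at a countable sequentially
dense set is a condensation onto a subspace of some `ℝ^D`, on which every continuous `h : X → ℝ`
becomes a pointwise limit of continuous functions, so that `{h ≠ 0}` becomes an `F_σ`-set.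
Conversely, put the metric space `Y` into the Hilbert cube `K`. For continuous `h : X → ℝ`, the
preimages of intervals are traces of `F_σ`-sets of `K`; prescribing for `φ n ∈ C(K, ℝ)` finitely
many of the conditions `h ∈ [a, b]` on the closed pieces of these sets yields `φ n → h` pointwise on
`X`, and `C(K, ℝ)` is separable.
-/

namespace CpSel

section FunctionallyClosedSets

variable {X : Type*} [TopologicalSpace X]

theorem IsZeroSet.isClosed {Z : Set X} (hZ : IsZeroSet Z) : IsClosed Z := by
  obtain ⟨f, hf, rfl⟩ := hZ
  exact isClosed_eq hf continuous_const

theorem IsCozeroSet.isOpen {U : Set X} (hU : IsCozeroSet U) : IsOpen U :=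
  isClosed_compl_iff.1 (IsZeroSet.isClosed hU)

theorem isZeroSet_le {f g : X → ℝ} (hf : Continuous f) (hg : Continuous g) :
    IsZeroSet {x | f x ≤ g x} := by
  refine ⟨fun x => max (f x - g x) 0, by fun_prop, ?_⟩
  ext x
  simp

theorem isCozeroSet_lt {f g : X → ℝ} (hf : Continuous f) (hg : Continuous g) :
    IsCozeroSet {x | f x < g x} := by
  simpa only [IsCozeroSet, compl_ofPred, not_lt] using isZeroSet_le hg hf

theorem isCozeroSet_preimage_Ioo {f : X → ℝ} (hf : Continuous f) (a b : ℝ) :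
    IsCozeroSet (f ⁻¹' Ioo a b) := by
  have h : IsCozeroSet {x | 0 < min (f x - a) (b - f x)} :=
    isCozeroSet_lt continuous_const (by fun_prop)
  simpa only [lt_min_iff, sub_pos, preimage, mem_Ioo] using h

theorem isZeroSet_biInter {ι : Type*} (s : Finset ι) {F : ι → Set X}
    (hF : ∀ i, IsZeroSet (F i)) : IsZeroSet (⋂ i ∈ s, F i) := by
  choose f hf hfF using hF
  refine ⟨fun x => ∑ i ∈ s, |f i x|, by fun_prop, ?_⟩
  ext x
  simp [hfF, Finset.sum_eq_zero_iff_of_nonneg]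

theorem isCozeroSet_biInter {ι : Type*} (s : Finset ι) {U : ι → Set X}
    (hU : ∀ i, IsCozeroSet (U i)) : IsCozeroSet (⋂ i ∈ s, U i) := by
  choose f hf hfU using hU
  refine ⟨fun x => ∏ i ∈ s, f i x, by fun_prop, ?_⟩
  ext x
  simp [hfU, Finset.prod_eq_zero_iff]

theorem exists_continuous_zero_one_of_isZeroSet {F U : Set X} (hF : IsZeroSet F)
    (hU : IsCozeroSet U) (hFU : F ⊆ U) :
    ∃ φ : X → ℝ, Continuous φ ∧ EqOn φ 0 F ∧ EqOn φ 1 Uᶜ := by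
  obtain ⟨f, hf, rfl⟩ := hF
  obtain ⟨g, hg, hgU⟩ := hU
  have hpos : ∀ x, |f x| + |g x| ≠ 0 := fun x hx => by
    rw [add_eq_zero_iff_of_nonneg (abs_nonneg _) (abs_nonneg _), abs_eq_zero, abs_eq_zero] at hx
    exact (hgU ▸ hx.2 : x ∈ Uᶜ) (hFU hx.1)
  refine ⟨fun x => |f x| / (|f x| + |g x|), by fun_prop (disch := exact hpos _), fun x hx => ?_,
    fun x hx => ?_⟩
  · simp [show f x = 0 from hx]
  · have hgx : g x = 0 := by rwa [hgU] at hx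
    have hfx := hpos x
    simp only [hgx, abs_zero, add_zero] at hfx ⊢
    exact div_self hfx

end FunctionallyClosedSets

section GammaCovers

variable {X ι : Type*}

theorem IsGammaCover.eventually_mem {𝒰 : Set (Set X)} (h𝒰 : IsGammaCover 𝒰) {U : ι → Set X}
    (hU : ∀ i, U i ∈ 𝒰) (hinj : Function.Injective U) (x : X) : ∀ᶠ i in cofinite, x ∈ U i :=
  ((h𝒰.2.2.2 x).preimage hinj.injOn).subset fun i hi => ⟨hU i, hi⟩

theorem isGammaCover_range [Infinite ι] {U : ι → Set X} (hne : ∀ i, U i ≠ univ)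
    (hU : ∀ x, ∀ᶠ i in cofinite, x ∈ U i) : IsGammaCover (range U) := by
  refine ⟨?_, ?_, fun hfin => ?_, fun x => ?_⟩
  · refine eq_univ_of_forall fun x => ?_
    obtain ⟨i, hi⟩ := (hU x).exists
    exact ⟨U i, mem_range_self i, hi⟩
  · rintro ⟨i, hi⟩
    exact hne i hi
  · -- A finite family of proper subsets omits one point from each member, and a single `U i`
    -- cannot contain all the omitted points.
    choose p hp using fun V : range U =>
      (ne_univ_iff_exists_notMem (V : Set X)).1 (by obtain ⟨_, i, rfl⟩ := V; exact hne i)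
    have := hfin.to_subtype
    obtain ⟨i, hi⟩ := (eventually_all.2 fun V => hU (p V)).exists
    exact hp ⟨U i, mem_range_self i⟩ (hi _)
  · refine (Finite.image U (hU x)).subset ?_
    rintro _ ⟨⟨i, rfl⟩, hi⟩
    exact ⟨i, hi, rfl⟩

theorem IsGammaCover.exists_strictMono {A : ℕ → Set X} (hA : IsGammaCover (range A)) :
    ∃ φ : ℕ → ℕ, StrictMono φ ∧ ∀ x, ∀ᶠ n in atTop, x ∈ A (φ n) := by
  obtain ⟨T, -, hT⟩ := exists_subset_bijOn univ A
  have hTinf : T.Infinite := by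
    refine fun hfin => hA.2.2.1 ?_
    rw [← image_univ, ← hT.image_eq]
    exact hfin.image A
  have hmono : StrictMono (Nat.nth (· ∈ T)) := Nat.nth_strictMono hTinf
  have hmem : ∀ n, Nat.nth (· ∈ T) n ∈ T := Nat.nth_mem_of_infinite hTinf
  refine ⟨Nat.nth (· ∈ T), hmono, fun x => ?_⟩
  rw [← Nat.cofinite_eq_atTop]
  exact hA.eventually_mem (fun n => mem_range_self _)
    (fun i j hij => hmono.injective (hT.injOn (hmem i) (hmem j) hij)) x

end GammaCovers

section ShrinkableCovers

variable {X : Type*} [TopologicalSpace X] {ι : Type*}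

/-- An indexed form of the members of `Γ_F`: cozero-sets `U i` together with zero-sets
`F i ⊆ U i` such that each point belongs to all but finitely many of the sets `F i`. Unlike in a
`γ`-cover, repetitions and sets equal to the whole space are allowed. -/
structure IsGammaShrinking (U F : ι → Set X) : Prop where
  isCozeroSet : ∀ i, IsCozeroSet (U i)
  isZeroSet : ∀ i, IsZeroSet (F i)
  subset : ∀ i, F i ⊆ U i
  eventually_mem : ∀ x, ∀ᶠ i in cofinite, x ∈ F i

theorem IsGammaShrinking.biInter {κ : Type*} {U F : κ → ι → Set X}
    (h : ∀ k, IsGammaShrinking (U k) (F k)) (s : Finset κ) :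
    IsGammaShrinking (fun i => ⋂ k ∈ s, U k i) (fun i => ⋂ k ∈ s, F k i) where
  isCozeroSet i := isCozeroSet_biInter s fun k => (h k).isCozeroSet i
  isZeroSet i := isZeroSet_biInter s fun k => (h k).isZeroSet i
  subset i := iInter₂_mono fun k _ => (h k).subset i
  eventually_mem x := by
    simpa only [mem_iInter, eventually_all_finset] using fun k _ => (h k).eventually_mem x

theorem IsGammaShrinking.exists_separating {U F : ι → Set X} (h : IsGammaShrinking U F) :
    ∃ φ : ι → Cp X, (∀ i, EqOn (φ i).1 0 (F i)) ∧ ∀ i, EqOn (φ i).1 1 (U i)ᶜ := by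
  choose φ hφ hφ0 hφ1 using fun i =>
    exists_continuous_zero_one_of_isZeroSet (h.isZeroSet i) (h.isCozeroSet i) (h.subset i)
  exact ⟨fun i => ⟨φ i, hφ i⟩, hφ0, hφ1⟩

theorem IsGammaShrinking.range_mem_gammaF [Infinite ι] {U F : ι → Set X}
    (h : IsGammaShrinking U F) (hne : ∀ i, U i ≠ univ) : range U ∈ GammaF X := by
  have hγ : IsGammaCover (range U) :=
    isGammaCover_range hne fun x => (h.eventually_mem x).mono fun i hi => h.subset i hi
  have : Infinite (range U) := hγ.2.2.1.to_subtype
  -- A member of `range U` may occur with several indices `i`, and we shrink it to a single `F i`.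
  choose! κ hκ using fun (V : Set X) (hV : V ∈ range U) => hV
  have hκinj : Function.Injective fun V : range U => κ V := fun V W hVW => by
    rw [← Subtype.coe_inj, ← hκ V V.2, ← hκ W W.2]
    exact congrArg U hVW
  have hFV : ∀ V ∈ range U, F (κ V) ⊆ V := fun V hV => (h.subset _).trans (hκ V hV).subset
  refine ⟨hγ, forall_mem_range.2 h.isCozeroSet, fun V => F (κ V), ?_,
    fun V hV => ⟨h.isZeroSet _, hFV V hV⟩⟩
  rw [image_eq_range]
  refine isGammaCover_range (fun V hV => hγ.2.1 ?_)
    fun x => hκinj.tendsto_cofinite.eventually (h.eventually_mem x)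
  rw [← univ_subset_iff.1 (hV ▸ hFV V V.2)]
  exact V.2

theorem exists_isGammaShrinking_of_mem_gammaF {𝒰 : Set (Set X)} (h𝒰 : 𝒰 ∈ GammaF X) :
    ∃ U F : ℕ → Set X, (∀ k, U k ∈ 𝒰) ∧ IsGammaShrinking U F := by
  obtain ⟨-, hcozero, G, hG, hGU⟩ := h𝒰
  let V := hG.2.2.1.natEmbedding
  choose U hU hUV using fun k => (V k).2
  refine ⟨U, fun k => V k, hU, fun k => hcozero _ (hU k), fun k => ?_, fun k => ?_,
    hG.eventually_mem (fun k => (V k).2) (Subtype.val_injective.comp V.injective)⟩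
  · exact hUV k ▸ (hGU _ (hU k)).1
  · exact hUV k ▸ (hGU _ (hU k)).2

variable (X) in
/-- The selection principle `U_fin(Γ_F, Γ)` for indexed covers. As members equal to the whole space
are allowed here, no proviso about finite subcovers is needed; this is the form of the
principle that passes directly to and from function spaces. -/
def IndexedUFin : Prop :=
  ∀ U F : ℕ → ℕ → Set X, (∀ n, IsGammaShrinking (U n) (F n)) →
    ∃ s : ℕ → Finset ℕ, ∀ x, ∀ᶠ n in atTop, ∃ k ∈ s n, x ∈ U n k

theorem IndexedUFin.uFin (h : IndexedUFin X) : UFin (GammaF X) (Gamma X) := by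
  intro 𝒰 h𝒰 hsub
  choose U F hU hUF using fun n => exists_isGammaShrinking_of_mem_gammaF (h𝒰 n)
  obtain ⟨s, hs⟩ := h U F hUF
  have hmem : ∀ n, U n '' s n ⊆ 𝒰 n := fun n => image_subset_iff.2 fun k _ => hU n k
  have hfinite : ∀ n, (U n '' s n).Finite := fun n => (s n).finite_toSet.image _
  refine ⟨fun n => U n '' s n, fun n => ⟨hmem n, hfinite n⟩,
    isGammaCover_range (fun n hn => hsub n ⟨_, hmem n, hfinite n, hn⟩) fun x => ?_,
    forall_mem_range.2 fun n => isOpen_sUnion ?_⟩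
  · rw [Nat.cofinite_eq_atTop]
    filter_upwards [hs x] with n ⟨k, hk, hx⟩
    exact ⟨U n k, mem_image_of_mem _ hk, hx⟩
  · exact forall_mem_image.2 fun k _ => ((hUF n).isCozeroSet k).isOpen

theorem UFin.exists_finset_of_biUnion_ne_univ (h : UFin (GammaF X) (Gamma X)) [Infinite ι]
    {U F : ℕ → ι → Set X} (hUF : ∀ n, IsGammaShrinking (U n) (F n))
    (hne : ∀ n (s : Finset ι), ⋃ k ∈ s, U n k ≠ univ) :
    ∃ s : ℕ → Finset ι, ∀ x, ∀ᶠ n in atTop, ∃ k ∈ s n, x ∈ U n k := by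
  -- The selection may repeat itself, so that only a subsequence `φ` of it eventually contains
  -- each point; as the covers `W n` refine one another, its term `φ n ≥ n` still works for `U n`.
  let W : ℕ → ι → Set X := fun n k => ⋂ i ∈ Finset.range (n + 1), U i k
  have hWU : ∀ {n i}, i ≤ n → ∀ k, W n k ⊆ U i k := fun hi k =>
    biInter_subset_of_mem (Finset.mem_range_succ_iff.2 hi)
  have hW : ∀ n (s : Finset ι), ⋃₀ (W n '' s) ≠ univ := fun n s hs => by
    rw [sUnion_image] at hs
    exact hne n s (univ_subset_iff.1 (hs ▸ iUnion₂_mono fun k _ => hWU le_rfl k))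
  have hfinset : ∀ n (ℱ : Set (Set X)), ℱ ⊆ range (W n) → ℱ.Finite →
      ∃ s : Finset ι, W n '' s = ℱ := fun n ℱ hℱ hfin => by
    rw [← image_univ] at hℱ
    obtain ⟨s, -, hs, rfl⟩ := exists_subset_image_finite_and.1 ⟨ℱ, hℱ, hfin, rfl⟩
    exact ⟨hs.toFinset, by rw [hs.coe_toFinset]⟩
  obtain ⟨ℱ, hℱ, hγ, -⟩ := h (fun n => range (W n))
    (fun n => (IsGammaShrinking.biInter hUF _).range_mem_gammaF fun k hk =>
      hW n {k} (by simpa only [Finset.coe_singleton, image_singleton, sUnion_singleton] using hk))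
    (by
      rintro n ⟨ℱ, hℱ, hfin, hcover⟩
      obtain ⟨s, rfl⟩ := hfinset n ℱ hℱ hfin
      exact hW n s hcover)
  choose s hs using fun n => hfinset n (ℱ n) (hℱ n).1 (hℱ n).2
  obtain ⟨φ, hφ, hmem⟩ := hγ.exists_strictMono
  refine ⟨fun n => s (φ n), fun x => ?_⟩
  filter_upwards [hmem x] with n hx
  rw [← hs] at hx
  obtain ⟨_, ⟨k, hk, rfl⟩, hxk⟩ := hx
  exact ⟨k, hk, hWU hφ.le_apply k hxk⟩

theorem UFin.indexedUFin (h : UFin (GammaF X) (Gamma X)) : IndexedUFin X := by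
  intro U F hUF
  classical
  by_cases hcov : ∀ n, ∃ s : Finset ℕ, ⋃ k ∈ s, U n k = univ
  · choose s hs using hcov
    exact ⟨s, fun x => Eventually.of_forall fun n => by simpa using (hs n).symm.subset (mem_univ x)⟩
  push Not at hcov
  obtain ⟨m, hm⟩ := hcov
  -- Replace each cover that has a finite subcover by the `m`-th one, which has none.
  let ν : ℕ → ℕ := fun n => if ∃ s : Finset ℕ, ⋃ k ∈ s, U n k = univ then m else n
  have hν : ∀ n (s : Finset ℕ), ⋃ k ∈ s, U (ν n) k ≠ univ := fun n => by
    by_cases hn : ∃ s : Finset ℕ, ⋃ k ∈ s, U n k = univ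
    · simpa only [ν, if_pos hn] using hm
    · simpa only [ν, if_neg hn] using not_exists.1 hn
  obtain ⟨s, hs⟩ := h.exists_finset_of_biUnion_ne_univ (fun n => hUF (ν n)) hν
  have hsel : ∀ n, ∃ t : Finset ℕ, ∀ x, (∃ k ∈ s n, x ∈ U (ν n) k) → ∃ k ∈ t, x ∈ U n k :=
    fun n => by
      by_cases hn : ∃ t : Finset ℕ, ⋃ k ∈ t, U n k = univ
      · obtain ⟨t, ht⟩ := hn
        exact ⟨t, fun x _ => by simpa using ht.symm.subset (mem_univ x)⟩
      · exact ⟨s n, fun x hx => by simpa only [ν, if_neg hn] using hx⟩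
  choose t ht using hsel
  exact ⟨t, fun x => (hs x).mono fun n => ht n x⟩

theorem uFin_gammaF_gamma_iff_indexedUFin : UFin (GammaF X) (Gamma X) ↔ IndexedUFin X :=
  ⟨UFin.indexedUFin, IndexedUFin.uFin⟩

end ShrinkableCovers

section SequentialDensity

variable {Z : Type*} [TopologicalSpace Z]

theorem mem_seqDense_iff {D : Set Z} :
    D ∈ SeqDense Z ↔ ∀ z, ∃ g : ℕ → Z, (∀ n, g n ∈ D) ∧ Tendsto g atTop (𝓝 z) :=
  eq_univ_iff_forall

theorem dense_of_mem_seqDense {D : Set Z} (hD : D ∈ SeqDense Z) : Dense D := fun z =>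
  seqClosure_subset_closure (eq_univ_iff_forall.1 hD z)

theorem SequentiallySeparable.separableSpace (hZ : SequentiallySeparable Z) :
    TopologicalSpace.SeparableSpace Z := by
  obtain ⟨D, hDc, hD⟩ := hZ
  exact ⟨D, hDc, dense_of_mem_seqDense hD⟩

theorem tendsto_cofinite_of_mem_gammaAt {z : Z} {A : Set Z} (hA : A ∈ GammaAt z) {ι : Type*}
    {g : ι → Z} (hg : ∀ i, g i ∈ A) (hinj : Function.Injective g) : Tendsto g cofinite (𝓝 z) :=
  fun V hV => ((hA.2.2 V hV).preimage hinj.injOn).subset fun i hi => ⟨hg i, hi⟩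

theorem exists_subset_mem_gammaAt [T1Space Z] {D : Set Z} (hD : D ∈ SeqDense Z) {z : Z}
    (hz : z ∉ D) : ∃ A ⊆ D, A ∈ GammaAt z := by
  obtain ⟨g, hgD, hg⟩ := mem_seqDense_iff.1 hD z
  have hsub : range g ⊆ D := range_subset_iff.2 hgD
  have hz' : z ∉ range g := fun h => hz (hsub h)
  refine ⟨range g, hsub, fun hfin => ?_, hz', fun V hV => ?_⟩
  · obtain ⟨n, hn⟩ := (hg.eventually (hfin.isClosed.compl_mem_nhds hz')).exists
    exact hn (mem_range_self n)
  · rw [← Nat.cofinite_eq_atTop] at hg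
    refine (Finite.image g (hg hV)).subset ?_
    rintro _ ⟨⟨n, rfl⟩, hn⟩
    exact ⟨n, hn, rfl⟩

end SequentialDensity

section Selection

variable {X : Type*} [TopologicalSpace X]

theorem tendsto_cp_iff {ι : Type*} {l : Filter ι} {g : ι → Cp X} {f : Cp X} :
    Tendsto g l (𝓝 f) ↔ ∀ x, Tendsto (fun i => (g i).1 x) l (𝓝 (f.1 x)) := by
  rw [tendsto_subtype_rng, tendsto_pi_nhds]

theorem continuous_cp_eval (x : X) : Continuous fun f : Cp X => f.1 x :=
  (continuous_apply x).comp continuous_subtype_val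

theorem separatesPoints_of_dense {D : Set (Cp X)} (hD : Dense D)
    (hsep : {f : X → ℝ | Continuous f}.SeparatesPoints) :
    (Subtype.val '' D : Set (X → ℝ)).SeparatesPoints := by
  intro x y hxy
  obtain ⟨f, hf, hfxy⟩ := hsep hxy
  have hopen : IsOpen {g : Cp X | g.1 x ≠ g.1 y} :=
    isOpen_ne_fun (continuous_cp_eval x) (continuous_cp_eval y)
  obtain ⟨d, hd, hdxy⟩ := hD.exists_mem_open hopen ⟨⟨f, hf⟩, hfxy⟩
  exact ⟨d.1, mem_image_of_mem _ hd, hdxy⟩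

theorem uConverges_iff {ℱ : ℕ → Set (Cp X)} {f : Cp X} :
    UConverges ℱ f ↔ ∀ x, ∀ ε > 0, ∀ᶠ n in atTop, ∃ g ∈ ℱ n, |g.1 x - f.1 x| < ε := by
  constructor
  · intro h x ε hε
    obtain ⟨N, hN⟩ := h {x} ε hε
    filter_upwards [eventually_gt_atTop N] with n hn
    exact hN n hn x (Finset.mem_singleton_self x)
  · intro h K ε hε
    obtain ⟨N, hN⟩ := eventually_atTop.1 ((eventually_all_finset K).2 fun x _ => h x ε hε)
    exact ⟨N, fun n hn => hN n hn.le⟩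

theorem UConverges.mono {ℱ 𝒢 : ℕ → Set (Cp X)} {f : Cp X} (h : UConverges ℱ f)
    (hsub : ∀ᶠ n in atTop, ℱ n ⊆ 𝒢 n) : UConverges 𝒢 f := by
  refine uConverges_iff.2 fun x ε hε => ?_
  filter_upwards [uConverges_iff.1 h x ε hε, hsub] with n ⟨g, hg, hgx⟩ hn
  exact ⟨g, hn hg, hgx⟩

theorem isClosed_setOf_uConverges (ℱ : ℕ → Set (Cp X)) : IsClosed {f | UConverges ℱ f} := by
  refine isClosed_of_closure_subset fun f hf => uConverges_iff.2 fun x ε hε => ?_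
  have hnhds : {h : Cp X | |h.1 x - f.1 x| < ε / 2} ∈ 𝓝 f :=
    (isOpen_lt ((continuous_cp_eval x).sub continuous_const).abs continuous_const).mem_nhds
      (by simpa using hε)
  obtain ⟨h, hhf, hh⟩ := mem_closure_iff_nhds.1 hf _ hnhds
  filter_upwards [uConverges_iff.1 hh x (ε / 2) (half_pos hε)] with n ⟨g, hg, hgh⟩
  refine ⟨g, hg, ?_⟩
  calc |g.1 x - f.1 x| ≤ |g.1 x - h.1 x| + |h.1 x - f.1 x| := abs_sub_le _ _ _
    _ < ε / 2 + ε / 2 := add_lt_add hgh hhf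
    _ = ε := add_halves ε

theorem isGammaShrinking_of_tendsto {ι : Type*} {g : ι → Cp X} {f : Cp X}
    (hg : Tendsto g cofinite (𝓝 f)) {ε : ℝ} (hε : 0 < ε) :
    IsGammaShrinking (fun i => {x | |(g i).1 x - f.1 x| < ε})
      (fun i => {x | |(g i).1 x - f.1 x| ≤ ε / 2}) where
  isCozeroSet i := isCozeroSet_lt ((g i).2.sub f.2).abs continuous_const
  isZeroSet i := isZeroSet_le ((g i).2.sub f.2).abs continuous_const
  subset _ _ hx := lt_of_le_of_lt hx (half_lt_self hε)
  eventually_mem x := (Metric.tendsto_nhds.1 (tendsto_cp_iff.1 hg x) _ (half_pos hε)).mono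
    fun _ hi => hi.le

theorem IsGammaShrinking.setOf_eqOn_one_mem_seqDense {U F : ℕ → Set X}
    (h : IsGammaShrinking U F) : {g : Cp X | ∃ k, EqOn g.1 1 (U k)ᶜ} ∈ SeqDense (Cp X) := by
  obtain ⟨φ, hφ0, hφ1⟩ := h.exists_separating
  refine mem_seqDense_iff.2 fun f =>
    ⟨fun k => ⟨fun x => f.1 x * (1 - (φ k).1 x) + (φ k).1 x, ?_⟩, fun k => ⟨k, fun x hx => ?_⟩,
      tendsto_cp_iff.2 fun x => tendsto_const_nhds.congr' ?_⟩
  · have := f.2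
    have := (φ k).2
    fun_prop
  · simp [hφ1 k hx]
  · rw [← Nat.cofinite_eq_atTop]
    filter_upwards [h.eventually_mem x] with k hk
    simp [hφ0 k hk]

theorem IndexedUFin.exists_uConverges (h : IndexedUFin X) (f : Cp X) {g : ℕ → ℕ → Cp X}
    (hg : ∀ n, Tendsto (g n) atTop (𝓝 f)) :
    ∃ s : ℕ → Finset ℕ, UConverges (fun n => g n '' s n) f := by
  obtain ⟨s, hs⟩ := h _ _ fun n =>
    isGammaShrinking_of_tendsto (Nat.cofinite_eq_atTop ▸ hg n) (Nat.one_div_pos_of_nat (n := n))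
  refine ⟨s, uConverges_iff.2 fun x ε hε => ?_⟩
  filter_upwards [hs x, tendsto_one_div_add_atTop_nhds_zero_nat.eventually_lt_const hε]
    with n ⟨k, hk, hx⟩ hn
  exact ⟨g n k, mem_image_of_mem _ hk, lt_trans hx hn⟩

theorem IndexedUFin.uFinGammaGamma (h : IndexedUFin X) : UFinGammaGamma X := by
  intro f S hS
  let g : ∀ n, ℕ ↪ S n := fun n => (hS n).1.natEmbedding
  obtain ⟨s, hs⟩ := h.exists_uConverges f (g := fun n k => g n k) fun n => by
    rw [← Nat.cofinite_eq_atTop]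
    exact tendsto_cofinite_of_mem_gammaAt (hS n) (fun k => (g n k).2)
      (Subtype.val_injective.comp (g n).injective)
  exact ⟨_, fun n => ⟨image_subset_iff.2 fun k _ => (g n k).2, (s n).finite_toSet.image _⟩, hs⟩

theorem IndexedUFin.uFinSS [TopologicalSpace.SeparableSpace (Cp X)] (h : IndexedUFin X) :
    UFinSS X := by
  intro S hS
  have : Nonempty (Cp X) := ⟨⟨0, continuous_const⟩⟩
  let d := TopologicalSpace.denseSeq (Cp X)
  choose g hgS hg using fun j n => mem_seqDense_iff.1 (hS n) (d j)
  choose s hs using fun j => h.exists_uConverges (d j) (hg j)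
  let ℱ : ℕ → Set (Cp X) := fun n => ⋃ j ∈ Iic n, g j n '' s j n
  have hℱd : ∀ j, UConverges ℱ (d j) := fun j => by
    refine (hs j).mono ?_
    filter_upwards [eventually_ge_atTop j] with n hn
    exact subset_biUnion_of_mem (u := fun j => g j n '' s j n) (mem_Iic.2 hn)
  refine ⟨ℱ, fun n => ⟨?_, (finite_Iic n).biUnion fun j _ => (s j n).finite_toSet.image _⟩,
    fun f => ?_⟩
  · exact iUnion₂_subset fun j _ => image_subset_iff.2 fun k _ => hgS j n k
  · exact closure_minimal (range_subset_iff.2 hℱd) (isClosed_setOf_uConverges ℱ)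
      (TopologicalSpace.denseRange_denseSeq (Cp X) f)

theorem UFinSS.uFinSGamma (h : UFinSS X) : UFinSGamma X := fun f S hS => by
  obtain ⟨ℱ, hℱ, hconv⟩ := h S hS
  exact ⟨ℱ, hℱ, hconv f⟩

theorem UFinGammaGamma.uFinSGamma (h : UFinGammaGamma X) : UFinSGamma X := by
  intro f S hS
  classical
  by_cases hall : ∀ n, f ∈ S n
  · refine ⟨fun _ => {f}, fun n => ⟨singleton_subset_iff.2 (hall n), finite_singleton f⟩, ?_⟩
    exact uConverges_iff.2 fun x ε hε => Eventually.of_forall fun _ => ⟨f, rfl, by simpa⟩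
  push Not at hall
  obtain ⟨m, hm⟩ := hall
  -- If `f ∈ S n`, then `S n` need not contain a set converging to `f`, so `S m` takes its place.
  have hA : ∀ n, ∃ A ∈ GammaAt f, f ∉ S n → A ⊆ S n := by
    intro n
    by_cases hn : f ∈ S n
    · obtain ⟨A, -, hA⟩ := exists_subset_mem_gammaAt (hS m) hm
      exact ⟨A, hA, fun h => absurd hn h⟩
    · obtain ⟨A, hAS, hA⟩ := exists_subset_mem_gammaAt (hS n) hn
      exact ⟨A, hA, fun _ => hAS⟩
  choose A hA hAS using hA
  obtain ⟨ℱ, hℱ, hconv⟩ := h f A hA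
  refine ⟨fun n => if f ∈ S n then {f} else ℱ n, ?_, uConverges_iff.2 fun x ε hε => ?_⟩
  · intro n
    dsimp only
    split_ifs with hn
    · exact ⟨singleton_subset_iff.2 hn, finite_singleton f⟩
    · exact ⟨(hℱ n).1.trans (hAS n hn), (hℱ n).2⟩
  · filter_upwards [uConverges_iff.1 hconv x ε hε] with n hn
    split_ifs
    · exact ⟨f, rfl, by simpa⟩
    · exact hn

theorem UFinSGamma.indexedUFin (h : UFinSGamma X) : IndexedUFin X := by
  intro U F hUF
  classical
  obtain ⟨ℱ, hℱ, hconv⟩ := h ⟨0, continuous_const⟩ _ fun n => (hUF n).setOf_eqOn_one_mem_seqDense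
  have hone : ∀ n, ∀ g ∈ ℱ n, ∃ k, EqOn g.1 1 (U n k)ᶜ := fun n => (hℱ n).1
  choose! κ hκ using hone
  refine ⟨fun n => (hℱ n).2.toFinset.image (κ n), fun x => ?_⟩
  filter_upwards [uConverges_iff.1 hconv x 1 one_pos] with n ⟨g, hg, hgx⟩
  refine ⟨κ n g, Finset.mem_image_of_mem _ ((hℱ n).2.mem_toFinset.2 hg), ?_⟩
  by_contra hx
  simp [hκ n g hg hx] at hgx

end Selection

section FSigma

variable {X : Type*} [TopologicalSpace X]

theorem isFSigma_iUnion {ι : Type*} [Countable ι] {C : ι → Set X} (hC : ∀ i, IsClosed (C i)) :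
    IsFSigma (⋃ i, C i) :=
  ⟨range C, countable_range C, forall_mem_range.2 hC, (sUnion_range C).symm⟩

theorem IsFSigma.exists_eq_iUnion_nat {A : Set X} (hA : IsFSigma A) :
    ∃ C : ℕ → Set X, (∀ k, IsClosed (C k)) ∧ A = ⋃ k, C k := by
  obtain ⟨T, hT, hTc, rfl⟩ := hA
  obtain ⟨C, hC⟩ := (hT.insert ∅).exists_eq_range (insert_nonempty _ _)
  have hclosed : ∀ V ∈ insert ∅ T, IsClosed V := forall_mem_insert.2 ⟨isClosed_empty, hTc⟩
  refine ⟨C, fun k => hclosed _ (hC ▸ mem_range_self k), ?_⟩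
  rw [← sUnion_range, ← hC, sUnion_insert, empty_union]

theorem isFSigma_of_isOpen [PerfectlyNormalSpace X] {U : Set X} (hU : IsOpen U) : IsFSigma U := by
  obtain ⟨V, hV, hUV⟩ := isGδ_iff_eq_iInter_nat.1 hU.isClosed_compl.isGδ
  rw [← compl_compl U, hUV, compl_iInter]
  exact isFSigma_iUnion fun n => (hV n).isClosed_compl

theorem IsFSigma.exists_preimage_eq {Y : Type*} [TopologicalSpace Y] {e : X → Y}
    (he : IsInducing e) {A : Set X} (hA : IsFSigma A) : ∃ B, IsFSigma B ∧ e ⁻¹' B = A := by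
  obtain ⟨C, hC, rfl⟩ := hA.exists_eq_iUnion_nat
  choose B hB hBC using fun k => he.isClosed_iff.1 (hC k)
  exact ⟨⋃ k, B k, isFSigma_iUnion hB, by simp only [preimage_iUnion, hBC]⟩

theorem isFSigma_setOf_ne_zero_of_tendsto {g : ℕ → X → ℝ} (hg : ∀ n, Continuous (g n))
    {h : X → ℝ} (hlim : ∀ x, Tendsto (fun n => g n x) atTop (𝓝 (h x))) :
    IsFSigma {x | h x ≠ 0} := by
  have heq : {x | h x ≠ 0} =
      ⋃ p : ℕ × ℕ, ⋂ n ≥ p.2, {x | 1 / ((p.1 : ℝ) + 1) ≤ |g n x|} := by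
    ext x
    simp only [mem_iUnion, mem_iInter, mem_ofPred_eq]
    constructor
    · intro hx
      obtain ⟨m, hm⟩ := exists_nat_one_div_lt (abs_pos.2 hx)
      obtain ⟨N, hN⟩ := eventually_atTop.1 ((hlim x).abs.eventually_const_lt hm)
      exact ⟨(m, N), fun n hn => (hN n hn).le⟩
    · rintro ⟨⟨m, N⟩, hp⟩
      have hle := ge_of_tendsto (hlim x).abs (eventually_atTop.2 ⟨N, hp⟩)
      exact abs_pos.1 (Nat.one_div_pos_of_nat.trans_le hle)
  rw [heq]
  exact isFSigma_iUnion fun p => isClosed_iInter fun n => isClosed_iInter fun _ =>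
    isClosed_le continuous_const (hg n).abs

end FSigma

section Interpolation

variable {K : Type*} [TopologicalSpace K] {ι : Type*}

theorem exists_continuous_forall_mem_convex_of_finite [NormalSpace K] [ParacompactSpace K]
    {E : Type*} [AddCommGroup E] [Module ℝ E] [TopologicalSpace E] [ContinuousAdd E]
    [ContinuousSMul ℝ E] [Finite ι] {C : ι → Set K} {t : ι → Set E} (hC : ∀ i, IsClosed (C i))
    (ht : ∀ i, Convex ℝ (t i)) (h : ∀ x, ∃ c, ∀ i, x ∈ C i → c ∈ t i) :
    ∃ φ : C(K, E), ∀ i, ∀ x ∈ C i, φ x ∈ t i := by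
  obtain ⟨φ, hφ⟩ := exists_continuous_forall_mem_convex_of_local_const
    (t := fun x => ⋂ i, ⋂ (_ : x ∈ C i), t i)
    (fun x => convex_iInter₂ fun i _ => ht i)
    (fun x => by
      have hnear : ∀ᶠ y in 𝓝 x, ∀ i, y ∈ C i → x ∈ C i :=
        eventually_all.2 fun i => by
          by_cases hx : x ∈ C i
          · exact Eventually.of_forall fun _ _ => hx
          · filter_upwards [(hC i).compl_mem_nhds hx] with y hy hy'
            exact absurd hy' hy
      obtain ⟨c, hc⟩ := h x
      refine ⟨c, ?_⟩
      filter_upwards [hnear] with y hy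
      exact mem_iInter₂.2 fun i hyi => hc i (hy i hyi))
  exact ⟨φ, fun i x hx => mem_iInter₂.1 (hφ x) i hx⟩

theorem exists_forall_mem_Icc_of_forall_le {α : Type*} [ConditionallyCompleteLattice α]
    [Nonempty α] {s : Set ι} {a b : ι → α} (h : ∀ i ∈ s, ∀ j ∈ s, a i ≤ b j) :
    ∃ c, ∀ i ∈ s, c ∈ Icc (a i) (b i) := by
  rcases s.eq_empty_or_nonempty with rfl | hs
  · exact ⟨Classical.arbitrary α, fun i hi => hi.elim⟩
  · obtain ⟨c, hac, hcb⟩ := exists_between_of_forall_le (hs.image a) (hs.image b)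
      (forall_mem_image.2 fun i hi => forall_mem_image.2 fun j hj => h i hi j hj)
    exact ⟨c, fun i hi => ⟨hac (mem_image_of_mem a hi), hcb (mem_image_of_mem b hi)⟩⟩

theorem exists_continuous_forall_mem_Icc [NormalSpace K] [ParacompactSpace K] [Finite ι]
    {C : ι → Set K} (hC : ∀ i, IsClosed (C i)) {a b : ι → ℝ}
    (h : ∀ i j, (C i ∩ C j).Nonempty → a i ≤ b j) :
    ∃ φ : C(K, ℝ), ∀ i, ∀ x ∈ C i, φ x ∈ Icc (a i) (b i) :=
  exists_continuous_forall_mem_convex_of_finite hC (fun i => convex_Icc (a i) (b i)) fun x =>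
    exists_forall_mem_Icc_of_forall_le (s := {i | x ∈ C i}) fun i hi j hj => h i j ⟨x, hi, hj⟩

theorem exists_isClosed_refinement_of_symm [PerfectlyNormalSpace K] {C : ℕ → Set K}
    (hC : ∀ i, IsClosed (C i)) {r : ℕ → ℕ → Prop} (hrefl : ∀ i, r i i)
    (hsymm : ∀ i j, r i j → r j i) :
    ∃ E : ℕ → ℕ → Set K, (∀ i k, IsClosed (E i k)) ∧ (∀ i k, E i k ⊆ C i) ∧
      (∀ i j k l, (E i k ∩ E j l).Nonempty → r i j) ∧
      ∀ i, ∀ x ∈ C i, (∀ j, x ∈ C j → r j i) → ∃ k, x ∈ E i k := by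
  -- Remove from `C i` the earlier sets not related to it: what is left is an `F_σ`-set.
  let B : ℕ → Set K := fun i => ⋃ j ∈ {j | j < i ∧ ¬ r j i}, C j
  have hB : ∀ i, IsClosed (B i) := fun i =>
    ((finite_lt_nat i).subset fun j hj => hj.1).isClosed_biUnion fun j _ => hC j
  choose D hDc hBD using fun i => (isFSigma_of_isOpen (hB i).isOpen_compl).exists_eq_iUnion_nat
  have hDB : ∀ i k, ∀ x ∈ D i k, x ∉ B i := fun i k x hx =>
    (hBD i).symm.subset (mem_iUnion_of_mem k hx)
  have hlt : ∀ i j k l, i < j → (C i ∩ D i k ∩ (C j ∩ D j l)).Nonempty → r i j := by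
    rintro i j k l hij ⟨x, ⟨hxi, -⟩, -, hxj⟩
    by_contra hr
    exact hDB j l x hxj (mem_biUnion (show i ∈ {i | i < j ∧ ¬ r i j} from ⟨hij, hr⟩) hxi)
  refine ⟨fun i k => C i ∩ D i k, fun i k => (hC i).inter (hDc i k), fun i k => inter_subset_left,
    fun i j k l hne => ?_, fun i x hx hr => ?_⟩
  · rcases lt_trichotomy i j with hij | rfl | hij
    · exact hlt i j k l hij hne
    · exact hrefl i
    · exact hsymm j i (hlt j i l k hij (inter_comm _ _ ▸ hne))
  · have hxB : x ∈ (B i)ᶜ := fun hmem => by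
      obtain ⟨j, hj, hxj⟩ := mem_iUnion₂.1 hmem
      exact hj.2 (hr j hxj)
    rw [hBD i] at hxB
    obtain ⟨k, hk⟩ := mem_iUnion.1 hxB
    exact ⟨k, hx, hk⟩

theorem exists_seq_tendsto_of_forall_mem_Icc [PerfectlyNormalSpace K] [ParacompactSpace K]
    {Y : Type*} {e : Y → K} {h : Y → ℝ} {C : ℕ → Set K} (hC : ∀ i, IsClosed (C i)) {a b : ℕ → ℝ}
    (hab : ∀ i, a i ≤ b i) (hCh : ∀ i y, e y ∈ C i → h y ∈ Icc (a i) (b i))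
    (hsmall : ∀ y, ∀ ε > 0, ∃ i, e y ∈ C i ∧ b i - a i < ε) :
    ∃ φ : ℕ → C(K, ℝ), ∀ y, Tendsto (fun n => φ n (e y)) atTop (𝓝 (h y)) := by
  obtain ⟨E, hE, -, hmeet, hEcover⟩ := exists_isClosed_refinement_of_symm hC
    (r := fun i j => a i ≤ b j ∧ a j ≤ b i) (fun i => ⟨hab i, hab i⟩) fun i j => And.symm
  choose φ hφ using fun n : ℕ => exists_continuous_forall_mem_Icc
    (C := fun p : Fin n × Fin n => E p.1 p.2) (a := fun p => a p.1) (b := fun p => b p.1)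
    (fun p => hE p.1 p.2) fun p q hpq => (hmeet p.1 q.1 p.2 q.2 hpq).1
  refine ⟨φ, fun y => Metric.tendsto_atTop.2 fun ε hε => ?_⟩
  obtain ⟨i, hyi, hlt⟩ := hsmall y ε hε
  have hyC : h y ∈ Icc (a i) (b i) := hCh i y hyi
  obtain ⟨k, hk⟩ := hEcover i (e y) hyi fun j hyj =>
    ⟨(hCh j y hyj).1.trans hyC.2, hyC.1.trans (hCh j y hyj).2⟩
  refine ⟨max i k + 1, fun n hn => ?_⟩
  have hyφ : φ n (e y) ∈ Icc (a i) (b i) :=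
    hφ n (⟨i, by omega⟩, ⟨k, by omega⟩) (e y) hk
  exact (Real.dist_le_of_mem_Icc hyφ hyC).trans_lt hlt

theorem exists_seq_tendsto_of_isFSigma_preimage_Ioo [PerfectlyNormalSpace K] [ParacompactSpace K]
    {Y : Type*} {e : Y → K} {h : Y → ℝ}
    (hσ : ∀ p q : ℝ, ∃ B : Set K, IsFSigma B ∧ e ⁻¹' B = h ⁻¹' Ioo p q) :
    ∃ φ : ℕ → C(K, ℝ), ∀ y, Tendsto (fun n => φ n (e y)) atTop (𝓝 (h y)) := by
  let δ : ℕ → ℝ := fun m => 1 / ((m : ℝ) + 1)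
  choose B hB hBh using fun (q : ℚ) (m : ℕ) => hσ (q - δ m) (q + δ m)
  choose C hC hBC using fun q m => (hB q m).exists_eq_iUnion_nat
  have hCh : ∀ q m y, (∃ k, e y ∈ C q m k) ↔ h y ∈ Ioo (q - δ m) (q + δ m) := fun q m y => by
    rw [← mem_iUnion, ← hBC, ← mem_preimage, hBh, mem_preimage]
  obtain ⟨σ, hsurj⟩ := exists_surjective_nat (ℚ × ℕ × ℕ)
  refine exists_seq_tendsto_of_forall_mem_Icc
    (C := fun i => C (σ i).1 (σ i).2.1 (σ i).2.2) (a := fun i => (σ i).1 - δ (σ i).2.1)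
    (b := fun i => (σ i).1 + δ (σ i).2.1) (fun i => hC _ _ _) (fun i => ?_)
    (fun i y hy => Ioo_subset_Icc_self ((hCh _ _ y).1 ⟨_, hy⟩)) fun y ε hε => ?_
  · have : 0 < δ (σ i).2.1 := Nat.one_div_pos_of_nat
    linarith
  · obtain ⟨m, hm⟩ := exists_nat_one_div_lt (half_pos hε)
    obtain ⟨q, hq⟩ := exists_rat_near (h y) (Nat.one_div_pos_of_nat (n := m))
    rw [abs_sub_lt_iff] at hq
    obtain ⟨k, hk⟩ := (hCh q m y).2 ⟨sub_lt_comm.1 hq.2, sub_lt_iff_lt_add'.1 hq.1⟩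
    obtain ⟨i, hi⟩ := hsurj (q, m, k)
    refine ⟨i, by simpa only [hi] using hk, ?_⟩
    simp only [hi]
    linarith

end Interpolation

section Condensation

variable {X : Type u} [TopologicalSpace X]

theorem sequentiallySeparable_cp_of_tendsto_comp {K : Type*} [TopologicalSpace K] [CompactSpace K]
    [TopologicalSpace.SeparableSpace C(K, ℝ)] {e : X → K} (he : Continuous e)
    (h : ∀ f : Cp X, ∃ φ : ℕ → C(K, ℝ), ∀ x, Tendsto (fun n => φ n (e x)) atTop (𝓝 (f.1 x))) :
    SequentiallySeparable (Cp X) := by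
  obtain ⟨D, hDc, hD⟩ := TopologicalSpace.exists_countable_dense C(K, ℝ)
  let r : C(K, ℝ) → Cp X := fun φ => ⟨φ ∘ e, φ.continuous.comp he⟩
  refine ⟨r '' D, hDc.image r, mem_seqDense_iff.2 fun f => ?_⟩
  obtain ⟨φ, hφ⟩ := h f
  choose d hd hdφ using fun n : ℕ => hD.exists_dist_lt (φ n) (Nat.one_div_pos_of_nat (n := n))
  refine ⟨fun n => r (d n), fun n => mem_image_of_mem r (hd n), tendsto_cp_iff.2 fun x => ?_⟩
  refine (hφ x).congr_dist (squeeze_zero (fun _ => dist_nonneg) (fun n => ?_)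
    tendsto_one_div_add_atTop_nhds_zero_nat)
  exact (ContinuousMap.dist_apply_le_dist _).trans (hdφ n).le

theorem PropertyV.sequentiallySeparable_cp (hX : PropertyV X) : SequentiallySeparable (Cp X) := by
  obtain ⟨Y, _, _, f, hf, hbij, hσ⟩ := hX
  obtain ⟨e, he⟩ := Metric.PiNatEmbed.exists_embedding_to_hilbert_cube (X := Y)
  refine sequentiallySeparable_cp_of_tendsto_comp (he.continuous.comp hf) fun h =>
    exists_seq_tendsto_of_isFSigma_preimage_Ioo fun p q => ?_
  obtain ⟨B, hB, hBe⟩ :=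
    (hσ _ (isCozeroSet_preimage_Ioo h.2 p q)).exists_preimage_eq he.isInducing
  exact ⟨B, hB, by rw [preimage_comp, hBe, preimage_image_eq _ hbij.injective]⟩

theorem SequentiallySeparable.propertyV (hsep : {f : X → ℝ | Continuous f}.SeparatesPoints)
    (hX : SequentiallySeparable (Cp X)) : PropertyV X := by
  obtain ⟨D, hDc, hD⟩ := hX
  have := hDc.to_subtype
  let E : X → D → ℝ := fun x d => d.1.1 x
  have hE : Continuous E := continuous_pi fun d => d.1.2
  have hinj : Function.Injective E := fun x y hxy => by
    by_contra hne
    obtain ⟨_, ⟨d, hd, rfl⟩, hdxy⟩ :=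
      separatesPoints_of_dense (dense_of_mem_seqDense hD) hsep hne
    exact hdxy (congrFun hxy ⟨d, hd⟩)
  let e : X ≃ range E := Equiv.ofInjective E hinj
  refine ⟨range E, TopologicalSpace.metrizableSpaceMetric _, inferInstance, e, hE.subtype_mk _,
    e.bijective, fun U hU => ?_⟩
  obtain ⟨h, hh, hUh⟩ := hU
  obtain ⟨g, hgD, hg⟩ := mem_seqDense_iff.1 hD ⟨h, hh⟩
  have himage : e '' U = {y | h (e.symm y) ≠ 0} := by
    rw [e.image_eq_preimage_symm, ← compl_compl U, hUh]
    rfl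
  have heval : ∀ n (y : range E), y.1 ⟨g n, hgD n⟩ = (g n).1 (e.symm y) := fun n y => by
    obtain ⟨x, rfl⟩ := e.surjective y
    rw [e.symm_apply_apply]
    rfl
  rw [himage]
  refine isFSigma_setOf_ne_zero_of_tendsto (g := fun n y => y.1 ⟨g n, hgD n⟩)
    (fun n => (continuous_apply _).comp continuous_subtype_val) fun y => ?_
  simpa only [heval] using tendsto_cp_iff.1 hg (e.symm y)

theorem sequentiallySeparable_cp_iff_propertyV
    (hsep : {f : X → ℝ | Continuous f}.SeparatesPoints) :
    SequentiallySeparable (Cp X) ↔ PropertyV X :=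
  ⟨SequentiallySeparable.propertyV hsep, PropertyV.sequentiallySeparable_cp⟩

end Condensation

end CpSel

theorem mainTheorem7_general (X : Type u) [TopologicalSpace X]
    (hsep : {f : X → ℝ | Continuous f}.SeparatesPoints) :
    List.TFAE [
      CpSel.UFinSS X ∧ CpSel.SequentiallySeparable (CpSel.Cp X),
      CpSel.UFin (CpSel.GammaF X) (CpSel.Gamma X) ∧ CpSel.PropertyV X,
      CpSel.UFinGammaGamma X ∧ CpSel.SequentiallySeparable (CpSel.Cp X),
      CpSel.UFinSGamma X ∧ CpSel.SequentiallySeparable (CpSel.Cp X)] := by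
  rw [CpSel.uFin_gammaF_gamma_iff_indexedUFin, ← CpSel.sequentiallySeparable_cp_iff_propertyV hsep]
  tfae_have 1 → 4 := And.imp_left CpSel.UFinSS.uFinSGamma
  tfae_have 3 → 4 := And.imp_left CpSel.UFinGammaGamma.uFinSGamma
  tfae_have 4 → 2 := And.imp_left CpSel.UFinSGamma.indexedUFin
  tfae_have 2 → 3 := And.imp_left CpSel.IndexedUFin.uFinGammaGamma
  tfae_have 2 → 1 := fun ⟨hX, hCp⟩ => have := hCp.separableSpace; ⟨hX.uFinSS, hCp⟩
  tfae_finish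

theorem mainTheorem7 (X : Type u) [TopologicalSpace X] [T35Space X] :
    List.TFAE [
      CpSel.UFinSS X ∧ CpSel.SequentiallySeparable (CpSel.Cp X),
      CpSel.UFin (CpSel.GammaF X) (CpSel.Gamma X) ∧ CpSel.PropertyV X,
      CpSel.UFinGammaGamma X ∧ CpSel.SequentiallySeparable (CpSel.Cp X),
      CpSel.UFinSGamma X ∧ CpSel.SequentiallySeparable (CpSel.Cp X)] :=
  mainTheorem7_general X separatesPoints_continuous_of_t35Space
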